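/- For natural numbers $n,k$ with $1\le k\le n$, the $(n,k)$-arrangement graph $A(n,k)$ is the graph whose vertices are the injective maps $\sigma:\{1,\dots,k\}\to\{1,\dots,n\}$, two such maps being adjacent if they agree on exactly $k-1$ elements of $\{1,\dots,k\}$. There is a polynomial $p(x)\in\mathbb{Q}[x]$ such that, for all natural numbers $n$ and $k$ with $1\le k\le n$ and $n>p(k)$, the number $-k$ is an eigenvalue of the adjacency matrix of $A(n,k)$, and it is the only negative eigenvalue of that matrix. Moreover, one may take $$p(x)=\tfrac16\,x(x+1)(x+5).$$ -/

import Mathlib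

/-- The `(n, k)`-arrangement graph: its vertices are the injective maps from `Fin k` to `Fin n`,
and two of them are adjacent when they agree at exactly `k - 1` points (the equation is written
`_ + 1 = k` to avoid truncated subtraction at `k = 0`). -/
def arrangementGraph (n k : ℕ) : SimpleGraph (Fin k ↪ Fin n) where
  Adj σ τ := (Finset.univ.filter fun i : Fin k => σ i = τ i).card + 1 = k
  symm := ⟨by
    intro σ τ h
    simpa only [eq_comm] using h⟩
  loopless := ⟨by
    intro σ h
    simp at h⟩

instance arrangementGraph.decidableAdj (n k : ℕ) : DecidableRel (arrangementGraph n k).Adj :=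
  fun σ τ => inferInstanceAs
    (Decidable ((Finset.univ.filter fun i : Fin k => σ i = τ i).card + 1 = k))

/-! The adjacency matrix of the arrangement graph is a sum of multiples of projections, minus `k`.
Let `P i` be the operator that sums a function on the injective maps `Fin k → Fin n` over all the
ways to change its `i`-th value. Then `∑ i, P i = A + k`, where `A` is the adjacency matrix, and
`P i = D • E i` with `D = n - k + 1` and `E i` an orthogonal projection. So `A ≥ -k`, and `-k` is
an eigenvalue as soon as some nonzero function is killed by every `P i`; for `2 * k ≤ n` the product
of the functions `δ_{2i} - δ_{2i+1}` in the `i`-th value is one (`adjMatrix_mulVec_pairProduct`).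

The projections almost commute. For `i ≠ j` freeze all the other values; `P i f` and `P j f` then
become functions `g` and `h` of one variable each, with `∑ g = ∑ h`, and their inner product over
pairs of distinct arguments is `(∑ g) * (∑ h) - ∑ g * h ≥ -(∑ g ^ 2 + ∑ h ^ 2) / 2`. Written for
`T i = ⟪f, P i f⟫ = ‖P i f‖ ^ 2 / D` this is `⟪P i f, P j f⟫ ≥ -(T i + T j) / 2`
(`sum_injective_lineSum_mul_lineSum_ge`). Summing over all pairs,
`‖∑ i, P i f‖ ^ 2 ≥ (D - (k - 1)) * ∑ i, T i`, so that an eigenvalue `θ` of `A` satisfies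
`(θ + k) ^ 2 ≥ (D - (k - 1)) * (θ + k)`. Hence `θ = -k` or `θ ≥ n - 3 * k + 2`
(`eigenvalue_eq_neg_or_ge`), and the cubic bound on `n` is more than enough to make the latter
nonnegative.

To avoid sums over varying sets of values, functions on injective maps are extended by zero to all
maps (`extendZero`), where `P i` becomes an unrestricted sum along a coordinate line (`lineSum`).
-/

open Finset Function

/-! ### Sums along coordinate lines -/

/-- The sum of `F` over the line through `s` in direction `i`. -/
def lineSum {ι α : Type*} [DecidableEq ι] [Fintype α] (i : ι) (F : (ι → α) → ℝ) (s : ι → α) : ℝ :=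
  ∑ x, F (update s i x)

theorem lineSum_update {ι α : Type*} [DecidableEq ι] [Fintype α] (i : ι) (F : (ι → α) → ℝ)
    (s : ι → α) (x : α) : lineSum i F (update s i x) = lineSum i F s := by
  simp [lineSum]

theorem lineSum_comm {ι α : Type*} [DecidableEq ι] [Fintype α] {i j : ι} (hij : i ≠ j)
    (F : (ι → α) → ℝ) : lineSum i (lineSum j F) = lineSum j (lineSum i F) := by
  funext s
  simp only [lineSum]
  rw [sum_comm]
  refine sum_congr rfl fun x _ => sum_congr rfl fun y _ => ?_
  rw [update_comm hij]

/-- Summing over lines counts every point of the cube `|α|` times. -/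
theorem sum_lineSum {ι α : Type*} [Fintype ι] [DecidableEq ι] [Fintype α] (i : ι)
    (F : (ι → α) → ℝ) : ∑ s, lineSum i F s = Fintype.card α * ∑ s, F s := by
  -- exchanging `s i` with the new value `x` is an involution of the pairs `(s, x)`
  have key : ∑ p : (ι → α) × α, F (update p.1 i p.2) = ∑ p : (ι → α) × α, F p.1 :=
    sum_nbij' (fun p => (update p.1 i p.2, p.1 i)) (fun p => (update p.1 i p.2, p.1 i))
      (by simp) (by simp) (by simp) (by simp) (by simp)
  rw [Fintype.sum_prod_type, Fintype.sum_prod_type] at key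
  simp only [lineSum, key, sum_const, card_univ, nsmul_eq_mul, ← mul_sum]

/-- A factor that is constant on the lines in direction `i` can be taken out of the line sum. -/
theorem sum_mul_lineSum {ι α : Type*} [Fintype ι] [DecidableEq ι] [Fintype α] (i : ι)
    (G H : (ι → α) → ℝ) (hG : ∀ s x, G (update s i x) = G s) :
    ∑ s, G s * lineSum i H s = Fintype.card α * ∑ s, G s * H s := by
  rw [← sum_lineSum i fun s => G s * H s]
  simp only [lineSum, hG, mul_sum]

theorem sum_lineSum_sq {ι α : Type*} [Fintype ι] [DecidableEq ι] [Fintype α] (i : ι)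
    (F : (ι → α) → ℝ) :
    ∑ s, lineSum i F s ^ 2 = Fintype.card α * ∑ s, F s * lineSum i F s := by
  simpa only [sq, mul_comm] using sum_mul_lineSum i (lineSum i F) F (lineSum_update i F)

theorem sum_mul_lineSum_self_nonneg {ι α : Type*} [Fintype ι] [DecidableEq ι] [Fintype α]
    [Nonempty α] (i : ι) (F : (ι → α) → ℝ) : 0 ≤ ∑ s, F s * lineSum i F s := by
  have hn : (0 : ℝ) < Fintype.card α := by exact_mod_cast Fintype.card_pos
  have h : 0 ≤ ∑ s, lineSum i F s ^ 2 := sum_nonneg fun s _ => sq_nonneg _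
  rw [sum_lineSum_sq] at h
  exact nonneg_of_mul_nonneg_right h hn

/-- On the full cube the line sums in two directions commute, so their product is positive. -/
theorem sum_lineSum_mul_lineSum_nonneg {ι α : Type*} [Fintype ι] [DecidableEq ι] [Fintype α]
    [Nonempty α] {i j : ι} (hij : i ≠ j) (F : (ι → α) → ℝ) :
    0 ≤ ∑ s, lineSum i F s * lineSum j F s := by
  have hn : (0 : ℝ) < Fintype.card α := by exact_mod_cast Fintype.card_pos
  have h1 := sum_mul_lineSum i (lineSum i F) (lineSum j F) (lineSum_update i F)
  have h2 := sum_mul_lineSum j (lineSum i (lineSum j F)) (lineSum i F) fun s x => by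
    rw [lineSum_comm hij, lineSum_update]
  rw [← lineSum_comm hij] at h2
  have h3 : 0 ≤ ∑ s, lineSum i (lineSum j F) s * lineSum i (lineSum j F) s :=
    sum_nonneg fun s _ => mul_self_nonneg _
  rw [h2] at h3
  simp only [mul_comm (lineSum i (lineSum j F) _)] at h3
  rw [h1] at h3
  exact nonneg_of_mul_nonneg_right (nonneg_of_mul_nonneg_right h3 hn) hn

/-- The line sums in direction `i` take the value at a given line once on `{s | s i = s j}`. -/
theorem sum_diagonal_lineSum_sq {ι α : Type*} [Fintype ι] [DecidableEq ι] [Fintype α]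
    [DecidableEq α] [Nonempty α] {i j : ι} (hij : i ≠ j) (F : (ι → α) → ℝ) :
    ∑ s with s i = s j, lineSum i F s ^ 2 = ∑ s, F s * lineSum i F s := by
  have hn : (Fintype.card α : ℝ) ≠ 0 := by exact_mod_cast Fintype.card_ne_zero
  have h := sum_mul_lineSum i (fun s => lineSum i F s ^ 2)
    (fun s => if s i = s j then 1 else 0) fun s x => by simp only [lineSum_update]
  have h1 : ∀ s : ι → α, lineSum i (fun s => if s i = s j then (1 : ℝ) else 0) s = 1 := by
    intro s
    simp [lineSum, hij.symm]
  simp only [h1, mul_one, sum_lineSum_sq] at h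
  rw [sum_filter]
  simpa using (mul_left_cancel₀ hn h).symm

/-! ### Functions supported on injective maps -/

/-- The points of a line in direction `i` that are injective maps: `|α| - |ι| + 1` of them, if
there is one. -/
theorem card_filter_injective_update {ι α : Type*} [Fintype ι] [DecidableEq ι] [Fintype α]
    [DecidableEq α] (i : ι) (s : ι → α) (x₀ : α) (h : Injective (update s i x₀)) :
    (#{x | Injective (update s i x)} : ℝ) = Fintype.card α - Fintype.card ι + 1 := by
  have hs : ∀ a b, a ≠ i → b ≠ i → s a = s b → a = b := fun a b ha hb hab =>
    h (by simpa [ha, hb] using hab)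
  have hset : ({x | Injective (update s i x)} : Finset α) = ((univ.erase i).image s)ᶜ := by
    ext x
    simp only [mem_filter_univ, mem_compl, mem_image, mem_erase, mem_univ, and_true, not_exists,
      not_and]
    constructor
    · intro hx a ha hax
      exact ha (hx (by simp [ha, hax]))
    · intro hx a b hab
      by_cases ha : a = i <;> by_cases hb : b = i
      · rw [ha, hb]
      · subst ha
        exact absurd (by simpa [hb] using hab.symm) (hx b hb)
      · subst hb
        exact absurd (by simpa [ha] using hab) (hx a ha)
      · exact hs a b ha hb (by simpa [ha, hb] using hab)
  have hcard : #((univ.erase i).image s) + 1 = Fintype.card ι := by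
    rw [card_image_of_injOn fun a ha b hb => hs a b (by simpa using ha) (by simpa using hb),
      card_erase_add_one (mem_univ i), card_univ]
  rw [hset, ← hcard, ← card_add_card_compl ((univ.erase i).image s)]
  push_cast
  ring

theorem exists_injective_update_of_lineSum_ne_zero {ι α : Type*} [DecidableEq ι] [Fintype α]
    {i : ι} {F : (ι → α) → ℝ} (hF : ∀ s, ¬ Injective s → F s = 0) {s : ι → α}
    (h : lineSum i F s ≠ 0) : ∃ x, Injective (update s i x) := by
  obtain ⟨x, -, hx⟩ := exists_ne_zero_of_sum_ne_zero h
  exact ⟨x, not_imp_comm.1 (hF _) hx⟩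

open scoped Classical in
theorem sum_injective_lineSum_sq {ι α : Type*} [Fintype ι] [DecidableEq ι] [Fintype α]
    [Nonempty α] (i : ι) (F : (ι → α) → ℝ) (hF : ∀ s, ¬ Injective s → F s = 0) :
    ∑ s with Injective s, lineSum i F s ^ 2 =
      (Fintype.card α - Fintype.card ι + 1) * ∑ s, F s * lineSum i F s := by
  have hn : (Fintype.card α : ℝ) ≠ 0 := by exact_mod_cast Fintype.card_ne_zero
  have h := sum_mul_lineSum i (fun s => lineSum i F s ^ 2)
    (fun s => if Injective s then 1 else 0) fun s x => by simp only [lineSum_update]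
  have h1 : ∀ s : ι → α,
      lineSum i F s ^ 2 * lineSum i (fun s => if Injective s then (1 : ℝ) else 0) s =
        (Fintype.card α - Fintype.card ι + 1) * lineSum i F s ^ 2 := by
    intro s
    by_cases h0 : lineSum i F s = 0
    · simp [h0]
    · obtain ⟨x, hx⟩ := exists_injective_update_of_lineSum_ne_zero hF h0
      rw [← card_filter_injective_update i s x hx, mul_comm]
      simp [lineSum]
  simp only [h1, ← mul_sum, sum_lineSum_sq] at h
  rw [sum_filter]
  apply mul_left_cancel₀ hn
  simp only [mul_ite, mul_one, mul_zero] at h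
  rw [← h]
  ring

open scoped Classical in
/-- The products of two line sums over injective maps differ from those over all maps by the
terms with `s i = s j`, because both line sums vanish unless `s` is injective off `i` and off
`j`. -/
theorem sum_injective_lineSum_mul_lineSum_ge {ι α : Type*} [Fintype ι] [DecidableEq ι]
    [Fintype α] [Nonempty α] {i j : ι} (hij : i ≠ j) (F : (ι → α) → ℝ)
    (hF : ∀ s, ¬ Injective s → F s = 0) :
    -((∑ s, F s * lineSum i F s + ∑ s, F s * lineSum j F s) / 2) ≤
      ∑ s with Injective s, lineSum i F s * lineSum j F s := by
  have hsplit : ∑ s, lineSum i F s * lineSum j F s =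
      ∑ s with Injective s, lineSum i F s * lineSum j F s +
        ∑ s with s i = s j, lineSum i F s * lineSum j F s := by
    rw [sum_filter, sum_filter, ← sum_add_distrib]
    refine sum_congr rfl fun s _ => ?_
    by_cases hs : Injective s
    · simp [hs, hs.ne hij]
    by_cases hd : s i = s j
    · simp [hs, hd]
    rw [if_neg hs, if_neg hd, add_zero, mul_eq_zero]
    by_contra! h0
    obtain ⟨x, hx⟩ := exists_injective_update_of_lineSum_ne_zero hF h0.1
    obtain ⟨y, hy⟩ := exists_injective_update_of_lineSum_ne_zero hF h0.2
    refine hs fun a b hab => ?_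
    by_contra hne
    have h1 : a = i ∨ b = i := by
      by_contra! h
      exact hne (hx (by simpa [h.1, h.2] using hab))
    have h2 : a = j ∨ b = j := by
      by_contra! h
      exact hne (hy (by simpa [h.1, h.2] using hab))
    grind
  have hpos := sum_lineSum_mul_lineSum_nonneg hij F
  have hi := sum_diagonal_lineSum_sq hij F
  have hj := sum_diagonal_lineSum_sq hij.symm F
  simp only [eq_comm (a := (_ : ι → α) j)] at hj
  have hle : ∑ s with s i = s j, lineSum i F s * lineSum j F s ≤
      ∑ s with s i = s j, (lineSum i F s ^ 2 + lineSum j F s ^ 2) / 2 :=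
    sum_le_sum fun s _ => by nlinarith [sq_nonneg (lineSum i F s - lineSum j F s)]
  rw [← sum_div, sum_add_distrib, hi, hj] at hle
  linarith

open scoped Classical in
/-- The quadratic inequality behind the spectral gap: if `∑ i, lineSum i F = c • F` on injective
maps, then `c ^ 2 ≥ (|α| - 2 * |ι| + 2) * c` and `c ≥ 0`. -/
theorem gap_of_sum_lineSum_eq {ι α : Type*} [Fintype ι] [DecidableEq ι] [Fintype α] [Nonempty α]
    {F : (ι → α) → ℝ} (hF : ∀ s, ¬ Injective s → F s = 0) (hF0 : F ≠ 0) {c : ℝ}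
    (hc : ∀ s, Injective s → ∑ i, lineSum i F s = c * F s) :
    0 ≤ c ∧ (Fintype.card α - 2 * Fintype.card ι + 2) * c ≤ c ^ 2 := by
  set D : ℝ := Fintype.card α - Fintype.card ι + 1 with hD
  set T : ι → ℝ := fun i => ∑ s, F s * lineSum i F s with hT
  have hpos : 0 < ∑ s, F s ^ 2 := by
    obtain ⟨s, hs⟩ := Function.ne_iff.1 hF0
    exact sum_pos' (fun s _ => sq_nonneg _) ⟨s, mem_univ s, by simpa using sq_pos_of_ne_zero hs⟩
  have hsumT : ∑ i, T i = c * ∑ s, F s ^ 2 := by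
    simp only [hT]
    rw [sum_comm, mul_sum]
    refine sum_congr rfl fun s _ => ?_
    rw [← mul_sum]
    by_cases hs : Injective s
    · rw [hc s hs]; ring
    · simp [hF s hs]
  have hTpos : 0 ≤ ∑ i, T i := sum_nonneg fun i _ => sum_mul_lineSum_self_nonneg i F
  have hnorm : ∑ s with Injective s, (∑ i, lineSum i F s) ^ 2 = c ^ 2 * ∑ s, F s ^ 2 := by
    rw [sum_filter, mul_sum]
    refine sum_congr rfl fun s _ => ?_
    by_cases hs : Injective s
    · simp [hs, hc s hs, mul_pow]
    · simp [hs, hF s hs]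
  have hexp : ∑ s with Injective s, (∑ i, lineSum i F s) ^ 2 =
      ∑ i, ∑ j, ∑ s with Injective s, lineSum i F s * lineSum j F s := by
    simp only [sq, sum_mul_sum]
    rw [sum_comm]
    refine sum_congr rfl fun i _ => ?_
    rw [sum_comm]
  -- the off-diagonal bound, with the diagonal term corrected to its exact value `D * T i`
  have hterm : ∀ i j, -((T i + T j) / 2) + (if i = j then (D + 1) * T i else 0) ≤
      ∑ s with Injective s, lineSum i F s * lineSum j F s := by
    intro i j
    by_cases hij : i = j
    · subst hij
      have := sum_injective_lineSum_sq i F hF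
      simp only [← sq, if_true, this]
      apply le_of_eq
      simp only [hT, hD]
      ring
    · simpa [hij] using sum_injective_lineSum_mul_lineSum_ge hij F hF
  have hsum : (D - (Fintype.card ι - 1)) * ∑ i, T i ≤ c ^ 2 * ∑ s, F s ^ 2 := by
    rw [← hnorm, hexp]
    refine le_trans (le_of_eq ?_) (sum_le_sum fun i _ => sum_le_sum fun j _ => hterm i j)
    simp only [sum_add_distrib, sum_neg_distrib, ← sum_div, sum_ite_eq, mem_univ, if_true,
      sum_const, card_univ, nsmul_eq_mul, ← mul_sum]
    ring
  rw [hsumT] at hTpos hsum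
  refine ⟨nonneg_of_mul_nonneg_left hTpos hpos, le_of_mul_le_mul_right ?_ hpos⟩
  calc _ = (D - (Fintype.card ι - 1)) * (c * ∑ s, F s ^ 2) := by rw [hD]; ring
    _ ≤ _ := hsum

/-! ### The adjacency operator of the arrangement graph -/

open scoped Classical in
/-- The extension by zero of a function on injective maps to all maps. -/
noncomputable def extendZero {ι α : Type*} (f : (ι ↪ α) → ℝ) (s : ι → α) : ℝ :=
  if h : Injective s then f ⟨s, h⟩ else 0

theorem extendZero_coe {ι α : Type*} (f : (ι ↪ α) → ℝ) (σ : ι ↪ α) : extendZero f σ = f σ :=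
  dif_pos σ.injective

theorem extendZero_of_not_injective {ι α : Type*} (f : (ι ↪ α) → ℝ) (s : ι → α)
    (h : ¬ Injective s) : extendZero f s = 0 :=
  dif_neg h

theorem extendZero_eq_sum {ι α : Type*} [Fintype ι] [DecidableEq ι] [Fintype α] [DecidableEq α]
    (f : (ι ↪ α) → ℝ) (s : ι → α) :
    extendZero f s = ∑ τ : ι ↪ α, if (τ : ι → α) = s then f τ else 0 := by
  by_cases h : Injective s
  · have : ∀ τ : ι ↪ α, (τ : ι → α) = s ↔ τ = ⟨s, h⟩ := fun τ =>
      (DFunLike.coe_injective.eq_iff (a := τ) (b := ⟨s, h⟩))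
    simp [extendZero, h, this]
  · rw [extendZero_of_not_injective f s h]
    refine (sum_eq_zero fun τ _ => if_neg ?_).symm
    rintro rfl
    exact h τ.injective

/-- Two injective maps lie on a common line in `k` directions if they are equal, in one direction
if they are adjacent, and in none otherwise. -/
theorem card_directions (n k : ℕ) (σ τ : Fin k ↪ Fin n) :
    #{i : Fin k | ∀ j, j ≠ i → τ j = σ j} =
      (if (arrangementGraph n k).Adj σ τ then 1 else 0) + if τ = σ then k else 0 := by
  have hadj : (arrangementGraph n k).Adj σ τ ↔ #{i : Fin k | σ i ≠ τ i} = 1 := by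
    have : #{i : Fin k | σ i = τ i} + #{i : Fin k | σ i ≠ τ i} = k := by
      rw [card_filter_add_card_filter_not, card_univ, Fintype.card_fin]
    change #{i : Fin k | σ i = τ i} + 1 = k ↔ _
    omega
  by_cases he : τ = σ
  · subst he
    simp
  rw [if_neg he, add_zero]
  by_cases h : (arrangementGraph n k).Adj σ τ
  · rw [if_pos h]
    obtain ⟨a, ha⟩ := card_eq_one.1 (hadj.1 h)
    have hmem : ∀ i, σ i ≠ τ i ↔ i = a := fun i => by
      simpa using Finset.ext_iff.1 ha i
    rw [card_eq_one]
    refine ⟨a, Finset.ext fun i => ?_⟩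
    simp only [mem_filter_univ, mem_singleton]
    constructor
    · intro hi
      by_contra hne
      exact (hmem a).2 rfl (hi a (Ne.symm hne)).symm
    · rintro rfl j hj
      exact (not_ne_iff.1 fun h' => hj ((hmem j).1 h')).symm
  · rw [if_neg h, card_eq_zero, filter_eq_empty_iff]
    intro i _ hi
    apply h
    rw [hadj, card_eq_one]
    obtain ⟨b, hb⟩ := DFunLike.ne_iff.1 he
    refine ⟨i, Finset.ext fun j => ?_⟩
    simp only [mem_filter_univ, mem_singleton]
    grind

theorem sum_lineSum_extendZero (n k : ℕ) (f : (Fin k ↪ Fin n) → ℝ) (σ : Fin k ↪ Fin n) :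
    ∑ i, lineSum i (extendZero f) σ =
      ((arrangementGraph n k).adjMatrix ℝ).mulVec f σ + k * f σ := by
  have hline : ∀ i : Fin k, lineSum i (extendZero f) σ =
      ∑ τ : Fin k ↪ Fin n, if ∀ j, j ≠ i → τ j = σ j then f τ else 0 := by
    intro i
    simp only [lineSum, extendZero_eq_sum]
    rw [sum_comm]
    refine sum_congr rfl fun τ _ => ?_
    have : ∀ x, (τ : Fin k → Fin n) = update σ i x ↔ x = τ i ∧ ∀ j, j ≠ i → τ j = σ j := by
      intro x
      rw [eq_update_iff, eq_comm]
    by_cases h : ∀ j, j ≠ i → τ j = σ j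
    · simp only [this, and_iff_left h, if_pos h, sum_ite_eq', mem_univ, if_true]
    · simp only [this, h, and_false, if_false, sum_const_zero]
  have hcount : ∀ τ : Fin k ↪ Fin n,
      ∑ i : Fin k, (if ∀ j, j ≠ i → τ j = σ j then f τ else 0) =
        (if (arrangementGraph n k).Adj σ τ then f τ else 0) + if τ = σ then k * f τ else 0 := by
    intro τ
    rw [← sum_filter, sum_const, card_directions, nsmul_eq_mul]
    push_cast
    split_ifs <;> ring
  simp only [hline]
  rw [sum_comm, sum_congr rfl fun τ _ => hcount τ, sum_add_distrib]
  simp [Matrix.mulVec, dotProduct, SimpleGraph.adjMatrix_apply]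

theorem eigenvalue_eq_neg_or_ge {n k : ℕ} (hn : 0 < n) {f : (Fin k ↪ Fin n) → ℝ} (hf : f ≠ 0)
    {θ : ℝ} (h : ((arrangementGraph n k).adjMatrix ℝ).mulVec f = θ • f) :
    θ = -k ∨ (n : ℝ) - 3 * k + 2 ≤ θ := by
  have : Nonempty (Fin n) := ⟨⟨0, hn⟩⟩
  have hF0 : extendZero f ≠ 0 := by
    obtain ⟨σ, hσ⟩ := Function.ne_iff.1 hf
    exact Function.ne_iff.2 ⟨σ, by simpa [extendZero_coe] using hσ⟩
  obtain ⟨h0, hgap⟩ := gap_of_sum_lineSum_eq (extendZero_of_not_injective f) hF0 (c := θ + k)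
    fun s hs => by
      have := sum_lineSum_extendZero n k f ⟨s, hs⟩
      rw [h, Pi.smul_apply, smul_eq_mul, ← add_mul, ← extendZero_coe f] at this
      exact this
  simp only [Fintype.card_fin] at hgap
  rcases h0.eq_or_lt with h0 | h0
  · left; linarith
  · right
    have := le_of_mul_le_mul_right (hgap.trans_eq (sq _)) h0
    linarith

/-! ### An eigenvector for the least eigenvalue -/

/-- The function with value `1` at `2 * i`, value `-1` at `2 * i + 1`, and `0` elsewhere. -/
def pairSign (i x : ℕ) : ℝ :=
  if x = 2 * i then 1 else if x = 2 * i + 1 then -1 else 0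

/-- The product of the functions `pairSign i` in the `i`-th value. -/
def pairProduct {n k : ℕ} (σ : Fin k ↪ Fin n) : ℝ :=
  ∏ i : Fin k, pairSign i (σ i)

theorem extendZero_pairProduct {n k : ℕ} (s : Fin k → Fin n) :
    extendZero pairProduct s = ∏ i : Fin k, pairSign i (s i) := by
  by_cases h : Injective s
  · exact extendZero_coe pairProduct ⟨s, h⟩
  · -- the supports of the factors are disjoint, so that the product vanishes off injective maps
    rw [extendZero_of_not_injective _ s h]
    by_contra h0
    refine h fun a b hab => ?_
    have ha : pairSign a (s a) ≠ 0 := prod_ne_zero_iff.1 (Ne.symm h0) a (mem_univ a)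
    have hb : pairSign b (s b) ≠ 0 := prod_ne_zero_iff.1 (Ne.symm h0) b (mem_univ b)
    rw [hab] at ha
    simp only [pairSign] at ha hb
    apply Fin.ext
    split_ifs at ha hb <;> first | omega | simp_all

theorem sum_pairSign {n i : ℕ} (h : 2 * i + 1 < n) : ∑ x : Fin n, pairSign i x = 0 := by
  rw [Fin.sum_univ_eq_sum_range (pairSign i), sum_eq_add (2 * i) (2 * i + 1) (by omega)]
  · simp [pairSign]
  · intro c _ hc
    simp [pairSign, hc.1, hc.2]
  · intro hc
    simp at hc; omega
  · intro hc
    simp at hc; omega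

theorem adjMatrix_mulVec_pairProduct {n k : ℕ} (h : 2 * k ≤ n) :
    ((arrangementGraph n k).adjMatrix ℝ).mulVec pairProduct = (-(k : ℝ)) • pairProduct := by
  funext σ
  have hσ := sum_lineSum_extendZero n k pairProduct σ
  have h0 : ∀ i : Fin k, lineSum i (extendZero pairProduct) σ = 0 := by
    intro i
    have : ∀ x, extendZero pairProduct (update σ i x) =
        pairSign i x * ∏ j ∈ univ.erase i, pairSign j (σ j) := by
      intro x
      rw [extendZero_pairProduct, ← mul_prod_erase univ _ (mem_univ i), update_self]
      congr 1
      refine prod_congr rfl fun j hj => ?_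
      rw [update_of_ne (ne_of_mem_erase hj)]
    simp only [lineSum, this]
    rw [← sum_mul, sum_pairSign (by omega), zero_mul]
  simp only [h0, sum_const_zero] at hσ
  simp only [Pi.smul_apply, smul_eq_mul]
  linarith

theorem pairProduct_ne_zero {n k : ℕ} (h : 2 * k ≤ n) :
    (pairProduct : (Fin k ↪ Fin n) → ℝ) ≠ 0 := by
  refine Function.ne_iff.2 ⟨⟨fun i => ⟨2 * i, by omega⟩, fun a b hab => ?_⟩, ?_⟩
  · simpa [Fin.ext_iff] using hab
  · exact prod_ne_zero_iff.2 fun i _ => by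
      change pairSign i (2 * i) ≠ 0
      simp [pairSign]

/-! ### Negative eigenvalues -/

theorem proposition4p1 :
    ∃ p : Polynomial ℚ,
      p = Polynomial.C (1 / 6) * Polynomial.X * (Polynomial.X + 1) * (Polynomial.X + 5) ∧
      ∀ n k : ℕ, 1 ≤ k → p.eval (k : ℚ) < (n : ℚ) →
        {θ : ℝ | Module.End.HasEigenvalue
            (Matrix.toLin' ((arrangementGraph n k).adjMatrix ℝ)) θ ∧ θ < 0} = {-(k : ℝ)} := by
  refine ⟨_, rfl, fun n k hk hp => ?_⟩
  have hn : 3 * k ≤ n + 2 ∧ 2 * k ≤ n := by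
    simp only [Polynomial.eval_mul, Polynomial.eval_C, Polynomial.eval_X, Polynomial.eval_add,
      Polynomial.eval_one, Polynomial.eval_ofNat] at hp
    have hk' : (1 : ℚ) ≤ k := by exact_mod_cast hk
    obtain rfl | hk2 : k = 1 ∨ 2 ≤ k := by omega
    · norm_num at hp
      have : 2 < n := by exact_mod_cast hp
      omega
    · have hk2' : (2 : ℚ) ≤ k := by exact_mod_cast hk2
      have h18 : (18 : ℚ) ≤ (k + 1) * (k + 5) := by nlinarith
      have : (3 * k : ℚ) < n := by nlinarith
      have : 3 * k < n := by exact_mod_cast this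
      omega
  have hn0 : 0 < n := by omega
  ext θ
  simp only [Set.mem_ofPred_eq, Set.mem_singleton_iff]
  constructor
  · rintro ⟨hθ, hneg⟩
    obtain ⟨f, hf⟩ := hθ.exists_hasEigenvector
    refine (eigenvalue_eq_neg_or_ge hn0 hf.2 ?_).resolve_right fun hge => ?_
    · simpa only [Matrix.toLin'_apply] using hf.apply_eq_smul
    · have : (3 * k : ℝ) ≤ n + 2 := by exact_mod_cast hn.1
      linarith
  · rintro rfl
    refine ⟨Module.End.hasEigenvalue_of_hasEigenvector (x := pairProduct) ?_, ?_⟩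
    · rw [Module.End.hasEigenvector_iff, Module.End.mem_eigenspace_iff, Matrix.toLin'_apply]
      exact ⟨adjMatrix_mulVec_pairProduct hn.2, pairProduct_ne_zero hn.2⟩
    · have : (0 : ℝ) < k := by exact_mod_cast hk
      linarith
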